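/- **Game.** Let $L\in\mathbb R^{N\times M}$ be a loss matrix with rows $\ell_1,\dots,\ell_N$ and $H\in\Sigma^{N\times M}$ a signal matrix. In every round the player chooses a row $I$, the opponent a column $j$, the player suffers (but does not see) the loss $L_{I,j}$ and observes the signal $H_{I,j}$. Let $C_i=\{q\in\Delta_M:\ \ell_i\cdot q\le \ell_k\cdot q\ \text{for all }k\}$, and assume that the $C_i$ form a nondegenerate partition of the simplex $\Delta_M$: each $C_i$ is nonempty of dimension $M-1$, and $C_i\cap C_j$ has lower dimension for $i\ne j$. Actions $i,j$ are neighbors if $i=j$ or if $C_i\cap C_j$ is nonempty of dimension $M-2$; $N_i$ is the set of neighbors of $i$. Let $S_i$ be the $0/1$ matrix whose rows are indexed by the symbols $\sigma$ occurring in row $i$ of $H$, with $S_i(\sigma,j)=\mathbf 1\{H_{i,j}=\sigma\}$, and let $S_{(i,j)}$ be $S_i$ stacked on top of $S_j$. Assume that the game is locally observable, i.e. $\ell_i-\ell_j\in\operatorname{Im}S_{(i,j)}^{\mathsf T}$ for all neighbors $i,j$; fix any vectors $v_{(i,j)}$ with $\ell_j-\ell_i=S_{(i,j)}^{\mathsf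 T}v_{(i,j)}$ for all neighbors $i,j$, and let $\bar v=\max\|v_{(i,j)}\|_\infty$ over all pairs of neighbors. **Algorithm** (Neighborhood Watch, with learning rate $\eta$ and exploration $\gamma$). For each action $i$ a local algorithm keeps a distribution $x_i$ on $N_i$, initially uniform, and $q_i=(1-\gamma)x_i+(\gamma/|N_i|)\mathbf 1_{N_i}$. In round $t$, take a probability vector $p^t$ with $p^t=Q^tp^t$, where $Q^t=[q^t_1,\dots,q^t_N]$; draw $k_t\sim p^t$, play $I_t\sim q^t_{k_t}$, and let $j_t$ be the opponent's column. For all $i$ and $j\in N_i$ put $$b^t_{(i,j)}=v_{(i,j)}^{\mathsf T}\begin{bmatrix}\mathbf 1\{I_t=i\}\,S_i\\ \mathbf 1\{k_t=i\}\mathbf 1\{I_t=j\}\,S_j/q^t_i(j)\end{bmatrix}e_{j_t},$$ which depends only on the observed signal. Only the local algorithm $i=k_t$ is updated: with $\tilde f(j)$ the sum of $b^r_{(i,j)}$ over the rounds $r\le t$ after the previous update of $i$ for $j\in N_i$, and $\tilde f(j)=0$ for $j\notin N_i$, set $x_i(j)\leftarrow x_i(j)e^{-\eta\tilde f(j)}/\sum_l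 x_i(l)e^{-\eta\tilde f(l)}$. **Theorem.** Let $T$ be the number of rounds and $\eta=\sqrt{\log N/(24\bar v^2T)}$ (if $\bar v=0$ or $T=0$, put $\eta=0$). There is a choice of $\gamma\in[0,1/2)$, depending only on $N$, $T$ and $\bar v$, such that for every such game, every choice of the fixed points $p^t$, and every adversary (which may randomize, and may choose $j_t$ depending on the history $(k_r,I_r,j_r)_{r<t}$), the expected local internal regret of the algorithm satisfies $$\sup_{\phi}\ \mathbb E\Big\{\sum_{t=1}^T(e_{I_t}-e_{\phi(I_t)})^{\mathsf T}Le_{j_t}\Big\}\le 4N\bar v\sqrt{6(\log N)T},$$ where the supremum is over all local departure functions $\phi=\phi_{i\to j}$ ($\phi(i)=j$, and $\phi(h)=h$ for $h\ne i$), $j$ a neighbor of $i$. -/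

import Mathlib

open scoped Matrix

noncomputable section

namespace PartialMonitoring

/-! ### The game -/

section Game

variable {N M : ℕ} {A : Type*}

/-- The cell of action `i`: the mixed strategies of the opponent against which `i` is a best
response, i.e. minimizes the expected loss. Row `i` of the loss matrix is `L i`. -/
def cell (L : Matrix (Fin N) (Fin M) ℝ) (i : Fin N) : Set (Fin M → ℝ) :=
  {q | q ∈ stdSimplex ℝ (Fin M) ∧ ∀ k, L i ⬝ᵥ q ≤ L k ⬝ᵥ q}

/-- The (affine) dimension of a nonempty set of vectors. -/
def affDim (s : Set (Fin M → ℝ)) : ℕ := Module.finrank ℝ (vectorSpan ℝ s)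

/-- The cells form a nondegenerate partition of the simplex: every cell is nonempty and of the
full dimension `M - 1`, and two different cells overlap only in a set of lower dimension. -/
def Nondegenerate (L : Matrix (Fin N) (Fin M) ℝ) : Prop :=
  (∀ i, (cell L i).Nonempty ∧ affDim (cell L i) + 1 = M) ∧
    ∀ i j, i ≠ j → affDim (cell L i ∩ cell L j) + 1 < M

/-- Actions are neighbors if their cells share a facet, i.e. meet in a set of dimension `M - 2`;
by convention, every action is its own neighbor. -/
def Neighbor (L : Matrix (Fin N) (Fin M) ℝ) (i j : Fin N) : Prop :=
  i = j ∨ ((cell L i ∩ cell L j).Nonempty ∧ affDim (cell L i ∩ cell L j) + 2 = M)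

open Classical in
/-- The neighbor set `N_i`. -/
def nbrs (L : Matrix (Fin N) (Fin M) ℝ) (i : Fin N) : Finset (Fin N) :=
  Finset.univ.filter fun j => Neighbor L i j

variable [DecidableEq A]

/-- The signal matrix `S_i`; its rows are indexed by the symbols in row `i` of `H`. -/
def signal (H : Matrix (Fin N) (Fin M) A) (i : Fin N) :
    Matrix (Set.range (H i)) (Fin M) ℝ :=
  Matrix.of fun σ j => if H i j = σ then 1 else 0

/-- The matrix `S_(i,j)`: `S_i` stacked on top of `S_j`. -/
def signalPair (H : Matrix (Fin N) (Fin M) A) (i j : Fin N) :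
    Matrix (Set.range (H i) ⊕ Set.range (H j)) (Fin M) ℝ :=
  Matrix.fromRows (signal H i) (signal H j)

/-- Local observability. -/
def LocallyObservable (L : Matrix (Fin N) (Fin M) ℝ) (H : Matrix (Fin N) (Fin M) A) : Prop :=
  ∀ i j, Neighbor L i j →
    L i - L j ∈ LinearMap.range (Matrix.mulVecLin (signalPair H i j)ᵀ)

/-- Families `v i j = v_(i,j)` of vectors indexed like the rows of `S_(i,j)`. -/
abbrev ObsVectors (H : Matrix (Fin N) (Fin M) A) : Type _ :=
  ∀ i j : Fin N, Set.range (H i) ⊕ Set.range (H j) → ℝ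

/-- `v` is a family of local-observability vectors:
`ℓ_j - ℓ_i = S_(i,j)ᵀ v_(i,j)` for neighboring `i`, `j`. -/
def IsObsVectors (L : Matrix (Fin N) (Fin M) ℝ) (H : Matrix (Fin N) (Fin M) A)
    (v : ObsVectors H) : Prop :=
  ∀ i j, Neighbor L i j → L j - L i = (signalPair H i j)ᵀ *ᵥ v i j

/-- `b` is the largest sup-norm of the vectors `v_(i,j)`, `i` and `j` neighbors. -/
def IsMaxNorm (L : Matrix (Fin N) (Fin M) ℝ) (H : Matrix (Fin N) (Fin M) A)
    (v : ObsVectors H) (b : ℝ) : Prop :=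
  IsGreatest {c : ℝ | ∃ i j, Neighbor L i j ∧ c = ‖v i j‖} b

/-- Local departure functions `φ_{i→j}`, `j` a neighbor of `i`. -/
def IsLocalDeparture (L : Matrix (Fin N) (Fin M) ℝ) (φ : Fin N → Fin N) : Prop :=
  ∃ i j, Neighbor L i j ∧ φ = Function.update id i j

end Game

/-! ### The algorithm -/

/-- What happens in one round: the vertex `k` drawn by the meta algorithm, the action `I` that is
played, and the column `col` chosen by the opponent. -/
structure Round (N M : ℕ) where
  k : Fin N
  I : Fin N
  col : Fin M

/-- The history of the past rounds, the most recent one first. -/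
abbrev History (N M : ℕ) : Type := List (Round N M)

/-- The state of a local algorithm: the current distribution `x`, and for each `j` the sum `acc j`
of the estimates `b_(i,j)` over the rounds since the local algorithm was last run. -/
structure LocalState (N : ℕ) where
  x : Fin N → ℝ
  acc : Fin N → ℝ

section Algorithm

variable {N M : ℕ} {A : Type*} [DecidableEq A]

/-- The update of the exponential weights algorithm with learning rate `η` for the cost `f`. -/
def expWeights (η : ℝ) (x f : Fin N → ℝ) : Fin N → ℝ :=
  fun j => x j * Real.exp (-η * f j) / ∑ l, x l * Real.exp (-η * f l)

/-- The uniform distribution on the neighbor set `N_i`. -/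
def unif (L : Matrix (Fin N) (Fin M) ℝ) (i : Fin N) : Fin N → ℝ :=
  fun j => if j ∈ nbrs L i then 1 / ((nbrs L i).card : ℝ) else 0

/-- The distribution `(1 - γ) x + (γ / |N_i|) 1_{N_i}` played by the local algorithm `i`. -/
def mix (L : Matrix (Fin N) (Fin M) ℝ) (γ : ℝ) (i : Fin N) (x : Fin N → ℝ) : Fin N → ℝ :=
  fun j => (1 - γ) * x j + γ * unif L i j

/-- The estimate `b_(i,j)` obtained in the round `r`, where `q` is the distribution of the local
algorithm `i` in that round:
`v_(i,j)ᵀ [ 1{I = i} S_i ; 1{k = i} 1{I = j} S_j / q(j) ] e_col`. -/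
def estimate (H : Matrix (Fin N) (Fin M) A) (v : ObsVectors H) (i : Fin N) (q : Fin N → ℝ)
    (r : Round N M) (j : Fin N) : ℝ :=
  v i j ⬝ᵥ (Matrix.fromRows
    ((if r.I = i then (1 : ℝ) else 0) • signal H i)
    ((if r.k = i ∧ r.I = j then 1 / q j else 0) • signal H j)) *ᵥ Pi.single r.col 1

/-- The state of the local algorithm `i` after a given history. It starts from the uniform
distribution on `N_i`. In each round the new estimates are added to the accumulated ones; if the
algorithm `i` is run in this round, then the accumulated vector (with the coordinates outside `N_i`
set to zero) is passed to exponential weights, and the accumulation restarts. -/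
def localState (L : Matrix (Fin N) (Fin M) ℝ) (H : Matrix (Fin N) (Fin M) A) (v : ObsVectors H)
    (η γ : ℝ) (i : Fin N) : History N M → LocalState N
  | [] => ⟨unif L i, fun _ => 0⟩
  | r :: h =>
    let s := localState L H v η γ i h
    let acc' : Fin N → ℝ := fun j =>
      s.acc j + if j ∈ nbrs L i then estimate H v i (mix L γ i s.x) r j else 0
    if r.k = i then ⟨expWeights η s.x acc', fun _ => 0⟩ else ⟨s.x, acc'⟩

/-- The distribution `q_i` over actions that the local algorithm `i` uses in the round that follows
a given history. -/
def localDist (L : Matrix (Fin N) (Fin M) ℝ) (H : Matrix (Fin N) (Fin M) A) (v : ObsVectors H)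
    (η γ : ℝ) (h : History N M) (i : Fin N) : Fin N → ℝ :=
  mix L γ i (localState L H v η γ i h).x

/-- The matrix `Q = [q_1, …, q_N]`, with the columns `q_i`. -/
def flowMatrix (L : Matrix (Fin N) (Fin M) ℝ) (H : Matrix (Fin N) (Fin M) A) (v : ObsVectors H)
    (η γ : ℝ) (h : History N M) : Matrix (Fin N) (Fin N) ℝ :=
  Matrix.of fun a i => localDist L H v η γ h i a

/-- `p` is a way for the meta algorithm to find, in every round, a probability vector that
satisfies the flow condition `p = Q p`. -/
def IsStationaryChoice (L : Matrix (Fin N) (Fin M) ℝ) (H : Matrix (Fin N) (Fin M) A)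
    (v : ObsVectors H) (η γ : ℝ) (p : History N M → Fin N → ℝ) : Prop :=
  ∀ h, p h ∈ stdSimplex ℝ (Fin N) ∧ p h = flowMatrix L H v η γ h *ᵥ p h

/-- An adversary: given the history of the past rounds, it chooses its next column, possibly at
random. -/
def IsAdversary (adv : History N M → Fin M → ℝ) : Prop :=
  ∀ h, adv h ∈ stdSimplex ℝ (Fin M)

/-- The expectation of a function `F` of the history of the first `t` rounds, when in each round,
given the history `h` of the earlier ones, the vertex `k` is drawn from `p h`, the action `I` from
`q_k`, and, independently, the opponent's column from `adv h`. -/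
def expect (L : Matrix (Fin N) (Fin M) ℝ) (H : Matrix (Fin N) (Fin M) A) (v : ObsVectors H)
    (η γ : ℝ) (p : History N M → Fin N → ℝ) (adv : History N M → Fin M → ℝ) :
    ℕ → (History N M → ℝ) → ℝ
  | 0, F => F []
  | t + 1, F => expect L H v η γ p adv t fun h =>
      ∑ k, ∑ I, ∑ c, p h k * localDist L H v η γ h k I * adv h c * F (⟨k, I, c⟩ :: h)

/-- The regret `∑ₜ (e_{Iₜ} - e_{φ(Iₜ)})ᵀ L e_{jₜ}` for the departure function `φ`. -/
def regret (L : Matrix (Fin N) (Fin M) ℝ) (φ : Fin N → Fin N) (h : History N M) : ℝ :=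
  (h.map fun r => L r.I r.col - L (φ r.I) r.col).sum

end Algorithm

/-- The learning rate `η = √(log N / (24 v̄² T))`. -/
def learningRate (N T : ℕ) (vbar : ℝ) : ℝ :=
  Real.sqrt (Real.log N / (24 * vbar ^ 2 * T))

end PartialMonitoring

end

namespace PartialMonitoring

/-! ### Elementary inequalities -/

/-! The flow condition `p = Qp` makes drawing vertex `i` and playing action `i` equally likely, both
with probability `p i`. Hence the estimate for `(i,j)` has conditional mean `p i * (L j - L i)`,
although its two halves are observed on different events (`sum_mul_localEstimate`). It also turns
the loss of the play into the `p`-average of the losses of the local algorithms, so internal regret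
splits into the external regrets of the vertices.

The difficulty is the delay: estimates pile up at a vertex until it is next drawn, and an adaptive
adversary influences when that happens. Each vertex therefore carries a potential: minus the
log-weight of the comparator, plus the linear effect of the waiting estimates, plus `C * ((3/2)^n -
1)`, where `n` counts the plays of its action since the last update. With `ε = η * vbar` the waiting
vector is of size at most `n * vbar`, so an update costs on average at most `8 * N * ε^2 * (3/2)^n`
(`sum_second_order_le`). An update releases the reserve and a play raises it by half of `C *
(3/2)^n`. Both have probability at most `p i`, so for `C = 16 * N * ε^2` the cost is paid up to `p i
* C` (`sum_mul_localPotential_le`).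

Summing over vertices and adding the price of exploration, `η * regret` plus the total potential
grows by at most `24 * N * ε^2` per round in expectation. The potentials are nonnegative and start
at `log N` or less, which gives `mul_expect_regret_le`. The learning rate balances the two terms;
for small `T` the trivial bound `2 * vbar * T` suffices. -/

/-- After division by `exp u` this says that `(1 + u) * exp (-u) + u^2 / 2`, whose derivative is `u
* (1 - exp (-u))`, stays above its value `1` at zero. -/
theorem exp_sub_one_sub_le {u : ℝ} (hu : 0 ≤ u) :
    Real.exp u - 1 - u ≤ u ^ 2 / 2 * Real.exp u := by
  have hd : ∀ x : ℝ, HasDerivAt (fun x : ℝ => (1 + x) * Real.exp (-x) + x ^ 2 / 2)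
      (x * (1 - Real.exp (-x))) x := by
    intro x
    have h1 := ((hasDerivAt_id x).const_add 1).mul (hasDerivAt_neg x).exp
    have h2 := ((hasDerivAt_id x).pow 2).div_const 2
    refine (h1.add h2).congr_deriv ?_
    simp only [id]
    push_cast
    ring
  have hm : MonotoneOn (fun x : ℝ => (1 + x) * Real.exp (-x) + x ^ 2 / 2) (Set.Ici 0) := by
    refine monotoneOn_of_deriv_nonneg (convex_Ici 0)
      (fun x _ => (hd x).continuousAt.continuousWithinAt)
      (fun x _ => (hd x).differentiableAt.differentiableWithinAt) fun x hx => ?_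
    rw [(hd x).deriv]
    rw [interior_Ici] at hx
    have hx' : (0 : ℝ) < x := hx
    have : Real.exp (-x) ≤ 1 := Real.exp_le_one_iff.2 (by linarith)
    exact mul_nonneg hx'.le (by linarith)
  have h := hm (Set.mem_Ici.2 le_rfl) (Set.mem_Ici.2 hu) hu
  simp only [add_zero, neg_zero, Real.exp_zero, mul_one, ne_eq, OfNat.ofNat_ne_zero,
    not_false_eq_true, zero_pow, zero_div] at h
  have h3 := mul_le_mul_of_nonneg_right h (Real.exp_pos u).le
  have h4 : Real.exp (-u) * Real.exp u = 1 := by rw [← Real.exp_add]; simp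
  have h5 : ((1 + u) * Real.exp (-u) + u ^ 2 / 2) * Real.exp u
      = (1 + u) * (Real.exp (-u) * Real.exp u) + u ^ 2 / 2 * Real.exp u := by ring
  rw [h5, h4] at h3
  linarith

theorem exp_neg_sub_one_add_le {y u : ℝ} (h : |y| ≤ u) :
    Real.exp (-y) - 1 + y ≤ u ^ 2 / 2 * Real.exp u := by
  have h0 : Real.exp (-y) - 1 + y ≤ Real.exp |y| - 1 - |y| := by
    rcases le_total 0 y with hy | hy
    -- For `y ≥ 0` the comparison is `y ≤ sinh y`.
    · rw [abs_of_nonneg hy]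
      have := Real.self_le_sinh_iff.2 hy
      rw [Real.sinh_eq] at this
      linarith
    · rw [abs_of_nonpos hy]
      linarith
  refine h0.trans ((exp_sub_one_sub_le (abs_nonneg y)).trans ?_)
  gcongr

theorem exp_mul_succ_le {ε : ℝ} (hε : ε ≤ 1 / 48) (n : ℕ) :
    Real.exp (ε * (n + 1)) ≤ (48 / 47) ^ (n + 1) := by
  have h1 : Real.exp (1 / 48) ≤ 48 / 47 := by
    have := Real.add_one_le_exp (-(1 / 48 : ℝ))
    rw [Real.exp_neg] at this
    have h2 := Real.exp_pos (1 / 48)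
    rw [← one_div, le_div_iff₀ h2] at this
    linarith
  calc Real.exp (ε * (n + 1)) ≤ Real.exp ((n + 1 : ℕ) * (1 / 48)) := by
        apply Real.exp_le_exp.2
        push_cast
        rw [mul_comm]
        gcongr
    _ = Real.exp (1 / 48) ^ (n + 1) := Real.exp_nat_mul _ _
    _ ≤ _ := by gcongr

/-- The rate `3/2` absorbs polynomial factors and must stay below `2`, so that one more play raises
the reserve by less than an update releases. -/
theorem sq_mul_exp_le {ε : ℝ} (hε : ε ≤ 1 / 48) (n : ℕ) :
    ((n : ℝ) + 1) ^ 2 * Real.exp (ε * (n + 1)) ≤ 6 * (3 / 2) ^ n := by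
  have key : ((n : ℝ) + 1) ^ 2 * (48 / 47) ^ (n + 1) ≤ 6 * (3 / 2) ^ n := by
    -- The ratio of consecutive left sides drops below `3/2` only from `n = 4` on.
    rcases lt_or_ge n 4 with hn | hn
    · interval_cases n <;> norm_num
    · induction n, hn using Nat.le_induction with
      | base => norm_num
      | succ n hn ih =>
        have hn' : (4 : ℝ) ≤ n := by exact_mod_cast hn
        have h1 : (((n + 1 : ℕ) : ℝ) + 1) ^ 2 * (48 / 47) ≤ 3 / 2 * ((n : ℝ) + 1) ^ 2 := by
          push_cast
          nlinarith
        have h2 : (0 : ℝ) ≤ (48 / 47) ^ (n + 1) := by positivity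
        calc (((n + 1 : ℕ) : ℝ) + 1) ^ 2 * (48 / 47) ^ (n + 1 + 1)
            = ((((n + 1 : ℕ) : ℝ) + 1) ^ 2 * (48 / 47)) * (48 / 47) ^ (n + 1) := by ring
          _ ≤ (3 / 2 * ((n : ℝ) + 1) ^ 2) * (48 / 47) ^ (n + 1) := by gcongr
          _ = 3 / 2 * (((n : ℝ) + 1) ^ 2 * (48 / 47) ^ (n + 1)) := by ring
          _ ≤ 3 / 2 * (6 * (3 / 2) ^ n) := by gcongr
          _ = _ := by ring
  exact (mul_le_mul_of_nonneg_left (exp_mul_succ_le hε n) (by positivity)).trans key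

theorem mul_exp_le {ε : ℝ} (hε : ε ≤ 1 / 48) (n : ℕ) :
    ((n : ℝ) + 1) * Real.exp (ε * (n + 1)) ≤ 3 / 2 * (3 / 2) ^ n := by
  have key : ((n : ℝ) + 1) * (48 / 47) ^ (n + 1) ≤ 3 / 2 * (3 / 2) ^ n := by
    rcases lt_or_ge n 2 with hn | hn
    · interval_cases n <;> norm_num
    · induction n, hn using Nat.le_induction with
      | base => norm_num
      | succ n hn ih =>
        have hn' : (2 : ℝ) ≤ n := by exact_mod_cast hn
        have h1 : (((n + 1 : ℕ) : ℝ) + 1) * (48 / 47) ≤ 3 / 2 * ((n : ℝ) + 1) := by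
          push_cast
          linarith
        calc (((n + 1 : ℕ) : ℝ) + 1) * (48 / 47) ^ (n + 1 + 1)
            = ((((n + 1 : ℕ) : ℝ) + 1) * (48 / 47)) * (48 / 47) ^ (n + 1) := by ring
          _ ≤ (3 / 2 * ((n : ℝ) + 1)) * (48 / 47) ^ (n + 1) := by gcongr
          _ = 3 / 2 * (((n : ℝ) + 1) * (48 / 47) ^ (n + 1)) := by ring
          _ ≤ 3 / 2 * (3 / 2 * (3 / 2) ^ n) := by gcongr
          _ = _ := by ring
  exact (mul_le_mul_of_nonneg_left (exp_mul_succ_le hε n) (by positivity)).trans key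

theorem exp_le_geometric {ε : ℝ} (hε : ε ≤ 1 / 48) (n : ℕ) :
    Real.exp (ε * (n + 1)) ≤ 11 / 10 * (3 / 2) ^ n := by
  refine (exp_mul_succ_le hε n).trans ?_
  rw [pow_succ']
  have h : (48 / 47 : ℝ) ^ n ≤ (3 / 2) ^ n := pow_le_pow_left₀ (by norm_num) (by norm_num) n
  have h0 : (0 : ℝ) ≤ (48 / 47) ^ n := by positivity
  linarith

theorem sq_mul_exp_le_sub_one {ε : ℝ} (hε : ε ≤ 1 / 48) (n : ℕ) :
    (n : ℝ) ^ 2 * Real.exp (ε * n) ≤ 12 * ((3 / 2) ^ n - 1) := by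
  cases n with
  | zero => simp
  | succ n =>
    have h := sq_mul_exp_le hε n
    have h1 : (1 : ℝ) ≤ (3 / 2) ^ n := one_le_pow₀ (by norm_num)
    push_cast
    rw [pow_succ (3 / 2 : ℝ) n]
    linarith

/-- The expected second-order cost of one exponential weights update whose cost vector consists of
at most `n + 1` bounded terms and one importance-weighted term. -/
theorem sum_second_order_le {ι : Type*} [Fintype ι] [DecidableEq ι] {x q : ι → ℝ} {ε : ℝ} (n : ℕ)
    {y : ι → ι → ℝ} (hx : ∀ l, 0 ≤ x l) (hx1 : ∑ l, x l = 1) (hq : ∀ l, 0 ≤ q l)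
    (hq1 : ∑ l, q l = 1) (hxq : ∀ l, x l ≤ 12 / 11 * q l) (hε0 : 0 ≤ ε) (hε : ε ≤ 1 / 48)
    (hqε : ∀ l, x l ≠ 0 → 2 * ε ≤ q l)
    (hy : ∀ I l, x l ≠ 0 → |y I l| ≤ ε * (n + 1) + if I = l then ε / q l else 0)
    (hcard : 2 ≤ Fintype.card ι) :
    ∑ I, q I * ∑ l, x l * (Real.exp (-y I l) - 1 + y I l)
      ≤ 8 * Fintype.card ι * ε ^ 2 * (3 / 2) ^ n := by
  set a : ℝ := ε * (n + 1) with ha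
  have ha0 : 0 ≤ a := by positivity
  have hE : Real.exp (1 / 2) ≤ 5 / 3 := by
    have h1 := Real.exp_one_lt_d9
    have h2 : Real.exp (1 / 2) ^ 2 = Real.exp 1 := by
      rw [← Real.exp_nat_mul]; norm_num
    nlinarith [Real.exp_pos (1 / 2)]
  have hl : ∀ l, x l * ∑ I, q I * (Real.exp (-y I l) - 1 + y I l) ≤
      Real.exp a / 2 * (x l * a ^ 2 + 5 / 3 * (x l * a ^ 2 + 2 * x l * (a * ε)
        + 12 / 11 * ε ^ 2)) := by
    intro l
    rcases eq_or_ne (x l) 0 with h0 | h0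
    -- Outside the support nothing is assumed about `y`, but the weight vanishes.
    · rw [h0]
      simp only [zero_mul, mul_zero, zero_add]
      positivity
    have hxl : 0 < x l := lt_of_le_of_ne (hx l) (Ne.symm h0)
    have hql : 0 < q l := by have := hxq l; linarith
    have hquot : ε / q l ≤ 1 / 2 := by
      rw [div_le_iff₀ hql]; have := hqε l h0; linarith
    have hquot0 : 0 ≤ ε / q l := by positivity
    have h1 : ∑ I, q I * (Real.exp (-y I l) - 1 + y I l) ≤
        a ^ 2 / 2 * Real.exp a + q l * ((a + ε / q l) ^ 2 / 2 * Real.exp (a + ε / q l)) := by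
      calc ∑ I, q I * (Real.exp (-y I l) - 1 + y I l)
          ≤ ∑ I, (q I * (a ^ 2 / 2 * Real.exp a) + if I = l then
              q I * ((a + ε / q l) ^ 2 / 2 * Real.exp (a + ε / q l)) else 0) := by
            refine Finset.sum_le_sum fun I _ => ?_
            have h2 := exp_neg_sub_one_add_le (hy I l h0)
            have h3 : 0 ≤ q I * (a ^ 2 / 2 * Real.exp a) :=
              mul_nonneg (hq I) (by positivity)
            have h4 := mul_le_mul_of_nonneg_left h2 (hq I)
            split_ifs at h4 ⊢ with hI
            · linarith
            · simpa using h4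
        _ = _ := by
            rw [Finset.sum_add_distrib, ← Finset.sum_mul, hq1]
            simp
    have h2 : Real.exp (a + ε / q l) ≤ Real.exp a * (5 / 3) := by
      rw [Real.exp_add]
      gcongr
      exact (Real.exp_le_exp.2 hquot).trans hE
    -- Importance weighting has variance `x l / q l * ε^2`, bounded for each `l` because `q`
    -- dominates `x` up to `12/11`; summing over `l` produces the factor `card ι`.
    have h3 : x l * (q l * (a + ε / q l) ^ 2) ≤
        x l * a ^ 2 + 2 * x l * (a * ε) + 12 / 11 * ε ^ 2 := by
      have e1 : x l * (q l * (a + ε / q l) ^ 2)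
          = x l * a ^ 2 * q l + 2 * x l * (a * ε) + x l / q l * ε ^ 2 := by
        field_simp
        ring
      have e2 : x l / q l ≤ 12 / 11 := by
        rw [div_le_iff₀ hql]; exact hxq l
      have e3 : q l ≤ 1 := by
        rw [← hq1]; exact Finset.single_le_sum (fun i _ => hq i) (Finset.mem_univ l)
      rw [e1]
      have e4 := mul_le_mul_of_nonneg_left e3 (by positivity : 0 ≤ x l * a ^ 2)
      have e5 := mul_le_mul_of_nonneg_right e2 (sq_nonneg ε)
      linarith
    calc x l * ∑ I, q I * (Real.exp (-y I l) - 1 + y I l)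
        ≤ x l * (a ^ 2 / 2 * Real.exp a
            + q l * ((a + ε / q l) ^ 2 / 2 * (Real.exp a * (5 / 3)))) := by
          refine mul_le_mul_of_nonneg_left (h1.trans ?_) hxl.le
          gcongr
      _ = Real.exp a / 2 * (x l * a ^ 2 + 5 / 3 * (x l * (q l * (a + ε / q l) ^ 2))) := by ring
      _ ≤ _ := by gcongr
  have hsum : ∑ I, q I * ∑ l, x l * (Real.exp (-y I l) - 1 + y I l)
      = ∑ l, x l * ∑ I, q I * (Real.exp (-y I l) - 1 + y I l) := by
    simp only [Finset.mul_sum]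
    rw [Finset.sum_comm]
    exact Finset.sum_congr rfl fun _ _ => Finset.sum_congr rfl fun _ _ => by ring
  have hc : (2 : ℝ) ≤ Fintype.card ι := by exact_mod_cast hcard
  rw [hsum]
  refine (Finset.sum_le_sum fun l _ => hl l).trans ?_
  have hs : ∑ l, Real.exp a / 2 * (x l * a ^ 2 + 5 / 3 * (x l * a ^ 2 + 2 * x l * (a * ε)
        + 12 / 11 * ε ^ 2)) = Real.exp a / 2 * (a ^ 2 + 5 / 3 * (a ^ 2 + 2 * (a * ε)
        + Fintype.card ι * (12 / 11 * ε ^ 2))) := by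
    rw [← Finset.mul_sum]
    simp only [Finset.sum_add_distrib, ← Finset.mul_sum, ← Finset.sum_mul, hx1]
    simp
    ring
  rw [hs]
  have g1 := sq_mul_exp_le hε n
  have g2 := mul_exp_le hε n
  have g3 := exp_le_geometric hε n
  rw [← ha] at g1 g2 g3
  have hg : (0 : ℝ) ≤ (3 / 2) ^ n := by positivity
  calc Real.exp a / 2 * (a ^ 2 + 5 / 3 * (a ^ 2 + 2 * (a * ε) + Fintype.card ι * (12 / 11 * ε ^ 2)))
      = ε ^ 2 / 2 * (8 / 3 * (((n : ℝ) + 1) ^ 2 * Real.exp a)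
          + 10 / 3 * (((n : ℝ) + 1) * Real.exp a) + 20 / 11 * Fintype.card ι * Real.exp a) := by
        rw [ha]; ring
    _ ≤ ε ^ 2 / 2 * (8 / 3 * (6 * (3 / 2) ^ n) + 10 / 3 * (3 / 2 * (3 / 2) ^ n)
          + 20 / 11 * Fintype.card ι * (11 / 10 * (3 / 2) ^ n)) := by gcongr
    _ = ε ^ 2 / 2 * (3 / 2) ^ n * (21 + 2 * Fintype.card ι) := by ring
    -- `21 + 2 * card ≤ 16 * card` is where at least two actions are needed.
    _ ≤ ε ^ 2 / 2 * (3 / 2) ^ n * (16 * Fintype.card ι) := by gcongr; linarith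
    _ = _ := by ring

/-! ### Exponential weights -/

variable {N : ℕ}

theorem sum_mul_exp_pos {x f : Fin N → ℝ} (hx : ∀ l, 0 ≤ x l) (hx1 : ∑ l, x l = 1) (η : ℝ) :
    0 < ∑ l, x l * Real.exp (-η * f l) := by
  obtain ⟨l, -, hl⟩ := Finset.exists_ne_zero_of_sum_ne_zero (hx1.trans_ne one_ne_zero)
  exact Finset.sum_pos' (fun i _ => mul_nonneg (hx i) (Real.exp_pos _).le)
    ⟨l, Finset.mem_univ l, mul_pos (lt_of_le_of_ne (hx l) (Ne.symm hl)) (Real.exp_pos _)⟩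

theorem sum_expWeights {x f : Fin N → ℝ} (hx : ∀ l, 0 ≤ x l) (hx1 : ∑ l, x l = 1) (η : ℝ) :
    ∑ l, expWeights η x f l = 1 := by
  simp only [expWeights]
  rw [← Finset.sum_div, div_self (sum_mul_exp_pos hx hx1 η).ne']

theorem expWeights_pos {x f : Fin N → ℝ} (hx : ∀ l, 0 ≤ x l) (hx1 : ∑ l, x l = 1) (η : ℝ)
    {j : Fin N} (hj : 0 < x j) : 0 < expWeights η x f j :=
  div_pos (mul_pos hj (Real.exp_pos _)) (sum_mul_exp_pos hx hx1 η)

/-- The new log-weight is explicit up to the log of the normalizer `Z`, and `log Z ≤ Z - 1` turns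
the latter into a linear and a second-order term. -/
theorem neg_log_expWeights_le {x f : Fin N → ℝ} (hx : ∀ l, 0 ≤ x l) (hx1 : ∑ l, x l = 1) (η : ℝ)
    {j : Fin N} (hj : 0 < x j) :
    -Real.log (expWeights η x f j) ≤ -Real.log (x j) + η * (f j - ∑ l, x l * f l)
      + ∑ l, x l * (Real.exp (-(η * f l)) - 1 + η * f l) := by
  have hZ := sum_mul_exp_pos (f := f) hx hx1 η
  have h1 := Real.log_le_sub_one_of_pos hZ
  have h2 : ∑ l, x l * (Real.exp (-(η * f l)) - 1 + η * f l)
      = ∑ l, x l * Real.exp (-η * f l) - 1 + η * ∑ l, x l * f l := by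
    simp only [mul_add, mul_sub, Finset.sum_add_distrib, Finset.sum_sub_distrib, mul_one, hx1,
      neg_mul, Finset.mul_sum, mul_left_comm η]
  rw [h2, expWeights, Real.log_div (mul_pos hj (Real.exp_pos _)).ne' hZ.ne',
    Real.log_mul hj.ne' (Real.exp_pos _).ne', Real.log_exp]
  linarith

/-- The fictitious update shows that the regret against `j` is controlled by the current weight
of `j`. -/
theorem neg_log_add_nonneg {x f : Fin N → ℝ} (hx : ∀ l, 0 ≤ x l) (hx1 : ∑ l, x l = 1) (η : ℝ)
    {j : Fin N} (hj : 0 < x j) :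
    0 ≤ -Real.log (x j) + η * (f j - ∑ l, x l * f l)
      + ∑ l, x l * (Real.exp (-(η * f l)) - 1 + η * f l) := by
  refine le_trans ?_ (neg_log_expWeights_le hx hx1 η hj)
  have hpos : ∀ l, 0 ≤ expWeights η x f l := fun l =>
    div_nonneg (mul_nonneg (hx l) (Real.exp_pos _).le) (sum_mul_exp_pos hx hx1 η).le
  have h1 : expWeights η x f j ≤ 1 := by
    rw [← sum_expWeights (f := f) hx hx1 η]
    exact Finset.single_le_sum (fun i _ => hpos i) (Finset.mem_univ j)
  have := Real.log_nonpos (hpos j) h1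
  linarith

/-! ### Expectations over histories -/

section Expectation

variable {N M : ℕ} {A : Type*} [DecidableEq A] {L : Matrix (Fin N) (Fin M) ℝ}
  {H : Matrix (Fin N) (Fin M) A} {v : ObsVectors H} {η γ : ℝ}
  {p : History N M → Fin N → ℝ} {adv : History N M → Fin M → ℝ}

theorem expect_const_mul (c : ℝ) (t : ℕ) (F : History N M → ℝ) :
    expect L H v η γ p adv t (fun h => c * F h) = c * expect L H v η γ p adv t F := by
  induction t generalizing F with
  | zero => rfl
  | succ t ih =>
    simp only [expect]
    rw [← ih]
    congr 1
    funext h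
    simp only [Finset.mul_sum]
    exact Finset.sum_congr rfl fun _ _ => Finset.sum_congr rfl fun _ _ =>
      Finset.sum_congr rfl fun _ _ => by ring

theorem expect_mono (hw : ∀ h k I c, 0 ≤ p h k * localDist L H v η γ h k I * adv h c) (t : ℕ)
    {F G : History N M → ℝ} (hFG : ∀ h, F h ≤ G h) :
    expect L H v η γ p adv t F ≤ expect L H v η γ p adv t G := by
  induction t generalizing F G with
  | zero => exact hFG []
  | succ t ih =>
    refine ih fun h => ?_
    exact Finset.sum_le_sum fun k _ => Finset.sum_le_sum fun I _ => Finset.sum_le_sum fun c _ =>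
      mul_le_mul_of_nonneg_left (hFG _) (hw h k I c)

theorem sum_weights_mul (hadv : IsAdversary adv) (h : History N M) (D : ℝ)
    (hD : ∑ k, ∑ I, p h k * localDist L H v η γ h k I = 1) :
    ∑ k, ∑ I, ∑ c, p h k * localDist L H v η γ h k I * adv h c * D = D := by
  have h2 : ∀ k I, ∑ c, p h k * localDist L H v η γ h k I * adv h c * D
      = p h k * localDist L H v η γ h k I * D := fun k I => by
    rw [← Finset.sum_mul, ← Finset.mul_sum, (hadv h).2, mul_one]
  simp only [h2, ← Finset.sum_mul, hD, one_mul]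

theorem expect_add_const (hadv : IsAdversary adv)
    (hD : ∀ h, ∑ k, ∑ I, p h k * localDist L H v η γ h k I = 1) (D : ℝ) (t : ℕ)
    (F : History N M → ℝ) :
    expect L H v η γ p adv t (fun h => F h + D) = expect L H v η γ p adv t F + D := by
  induction t generalizing F with
  | zero => rfl
  | succ t ih =>
    simp only [expect]
    rw [← ih]
    congr 1
    funext h
    simp only [mul_add, Finset.sum_add_distrib, sum_weights_mul hadv h D (hD h)]

/-- A function of the history that grows by at most `C` per round, in conditional expectation given
any column of the opponent, has expectation at most its initial value plus `C` per round. -/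
theorem expect_le_of_drift (hadv : IsAdversary adv)
    (hw : ∀ h k I, 0 ≤ p h k * localDist L H v η γ h k I)
    (hD : ∀ h, ∑ k, ∑ I, p h k * localDist L H v η γ h k I = 1) {F : History N M → ℝ} {C : ℝ}
    (hF : ∀ h c, ∑ k, ∑ I, p h k * localDist L H v η γ h k I * F (⟨k, I, c⟩ :: h) ≤ F h + C)
    (t : ℕ) : expect L H v η γ p adv t F ≤ F [] + t * C := by
  induction t with
  | zero => simp [expect]
  | succ t ih =>
    have hstep : ∀ h, ∑ k, ∑ I, ∑ c, p h k * localDist L H v η γ h k I * adv h c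
        * F (⟨k, I, c⟩ :: h) ≤ F h + C := by
      intro h
      have e : ∑ k, ∑ I, ∑ c, p h k * localDist L H v η γ h k I * adv h c * F (⟨k, I, c⟩ :: h)
          = ∑ c, adv h c * ∑ k, ∑ I, p h k * localDist L H v η γ h k I
              * F (⟨k, I, c⟩ :: h) := by
        simp only [Finset.mul_sum]
        rw [Finset.sum_comm_cycle]
        refine Finset.sum_congr rfl fun _ _ => Finset.sum_congr rfl fun _ _ =>
          Finset.sum_congr rfl fun _ _ => by ring
      rw [e]
      calc _ ≤ ∑ c, adv h c * (F h + C) :=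
            Finset.sum_le_sum fun c _ => mul_le_mul_of_nonneg_left (hF h c) ((hadv h).1 c)
        _ = F h + C := by rw [← Finset.sum_mul, (hadv h).2, one_mul]
    have h1 := expect_mono (fun h k I c => mul_nonneg (hw h k I) ((hadv h).1 c)) t hstep
    rw [expect_add_const hadv hD] at h1
    simp only [expect]
    push_cast
    linarith

end Expectation

/-! ### Neighbors and observations -/

section Observations

variable {N M : ℕ} {A : Type*} [DecidableEq A] {L : Matrix (Fin N) (Fin M) ℝ}
  {H : Matrix (Fin N) (Fin M) A} {v : ObsVectors H} {vbar : ℝ}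

theorem mem_nbrs {i j : Fin N} : j ∈ nbrs L i ↔ Neighbor L i j := by
  simp [nbrs]

theorem self_mem_nbrs (i : Fin N) : i ∈ nbrs L i := mem_nbrs.2 (Or.inl rfl)

theorem card_nbrs_pos (i : Fin N) : (0 : ℝ) < (nbrs L i).card := by
  exact_mod_cast Finset.card_pos.2 ⟨i, self_mem_nbrs i⟩

theorem card_nbrs_le (i : Fin N) : ((nbrs L i).card : ℝ) ≤ N := by
  exact_mod_cast (Finset.card_le_univ _).trans (Fintype.card_fin N).le

/-- The entry of `v_(i,j)` selected by the signal of action `i`. -/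
def ownWeight (v : ObsVectors H) (i j : Fin N) (c : Fin M) : ℝ := v i j (Sum.inl ⟨H i c, c, rfl⟩)

/-- The entry of `v_(i,j)` selected by the signal of action `j`. -/
def otherWeight (v : ObsVectors H) (i j : Fin N) (c : Fin M) : ℝ :=
  v i j (Sum.inr ⟨H j c, c, rfl⟩)

theorem sum_signal (i : Fin N) (c : Fin M) (f : Set.range (H i) → ℝ) :
    ∑ σ, f σ * signal H i σ c = f ⟨H i c, c, rfl⟩ := by
  rw [Finset.sum_eq_single ⟨H i c, c, rfl⟩]
  · simp [signal]
  · intro σ _ hσ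
    have : H i c ≠ σ := fun h => hσ (Subtype.ext h.symm)
    simp [signal, this]
  · simp

theorem estimate_eq (i : Fin N) (q : Fin N → ℝ) (r : Round N M) (j : Fin N) :
    estimate H v i q r j = (if r.I = i then ownWeight v i j r.col else 0)
      + if r.k = i ∧ r.I = j then otherWeight v i j r.col / q j else 0 := by
  rw [estimate, Matrix.mulVec_single_one, dotProduct, Fintype.sum_sum_type]
  congr 1
  · simp only [Matrix.col_apply, Matrix.fromRows_apply_inl, Matrix.smul_apply, smul_eq_mul]
    split_ifs
    · simp only [one_mul]
      exact sum_signal i r.col fun σ => v i j (Sum.inl σ)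
    · simp
  · simp only [Matrix.col_apply, Matrix.fromRows_apply_inr, Matrix.smul_apply, smul_eq_mul]
    split_ifs
    · simp only [mul_left_comm _ (1 / q j), ← Finset.mul_sum]
      rw [sum_signal j r.col fun σ => v i j (Sum.inr σ), otherWeight]
      ring
    · simp

theorem ownWeight_add_otherWeight (hv : IsObsVectors L H v) {i j : Fin N} (hij : Neighbor L i j)
    (c : Fin M) : ownWeight v i j c + otherWeight v i j c = L j c - L i c := by
  have h := congrFun (hv i j hij) c
  rw [Pi.sub_apply] at h
  rw [h, Matrix.mulVec_transpose, Matrix.vecMul, dotProduct, Fintype.sum_sum_type]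
  simp only [signalPair, Matrix.fromRows_apply_inl, Matrix.fromRows_apply_inr]
  rw [sum_signal i c fun σ => v i j (Sum.inl σ), sum_signal j c fun σ => v i j (Sum.inr σ)]
  rfl

theorem norm_le_of_isMaxNorm (hb : IsMaxNorm L H v vbar) {i j : Fin N} (hij : Neighbor L i j) :
    ‖v i j‖ ≤ vbar :=
  hb.2 ⟨i, j, hij, rfl⟩

theorem abs_ownWeight_le (hb : IsMaxNorm L H v vbar) {i j : Fin N} (hij : Neighbor L i j)
    (c : Fin M) : |ownWeight v i j c| ≤ vbar :=
  (norm_le_pi_norm (v i j) _).trans (norm_le_of_isMaxNorm hb hij)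

theorem abs_otherWeight_le (hb : IsMaxNorm L H v vbar) {i j : Fin N} (hij : Neighbor L i j)
    (c : Fin M) : |otherWeight v i j c| ≤ vbar :=
  (norm_le_pi_norm (v i j) _).trans (norm_le_of_isMaxNorm hb hij)

theorem abs_loss_sub_le (hv : IsObsVectors L H v) (hb : IsMaxNorm L H v vbar) {i j : Fin N}
    (hij : Neighbor L i j) (c : Fin M) : |L j c - L i c| ≤ 2 * vbar := by
  rw [← ownWeight_add_otherWeight hv hij c]
  refine (abs_add_le _ _).trans ?_
  linarith [abs_ownWeight_le hb hij c, abs_otherWeight_le hb hij c]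

end Observations

/-! ### The state of the local algorithms -/

section State

variable {N M : ℕ} {A : Type*} [DecidableEq A] {L : Matrix (Fin N) (Fin M) ℝ}
  {H : Matrix (Fin N) (Fin M) A} {v : ObsVectors H} {η γ vbar : ℝ}

theorem unif_nonneg (i j : Fin N) : 0 ≤ unif L i j := by
  unfold unif
  split_ifs
  · positivity
  · exact le_rfl

theorem unif_eq_zero {i j : Fin N} (hj : j ∉ nbrs L i) : unif L i j = 0 := if_neg hj

theorem unif_of_mem {i j : Fin N} (hj : j ∈ nbrs L i) : unif L i j = 1 / (nbrs L i).card :=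
  if_pos hj

theorem sum_unif (i : Fin N) : ∑ j, unif L i j = 1 := by
  simp only [unif, ← Finset.sum_filter, Finset.filter_mem_eq_inter, Finset.univ_inter,
    Finset.sum_const, nsmul_eq_mul]
  exact mul_one_div_cancel (card_nbrs_pos i).ne'

/-- The estimates of the local algorithm `i` in round `r` after the history `h`, set to zero
outside `N_i`. -/
noncomputable def localEstimate (L : Matrix (Fin N) (Fin M) ℝ) (H : Matrix (Fin N) (Fin M) A) (v : ObsVectors H)
    (η γ : ℝ) (i : Fin N) (h : History N M) (r : Round N M) (j : Fin N) : ℝ :=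
  if j ∈ nbrs L i then estimate H v i (localDist L H v η γ h i) r j else 0

theorem localState_cons_of_eq {i : Fin N} {r : Round N M} (h : History N M) (hr : r.k = i) :
    localState L H v η γ i (r :: h) = ⟨expWeights η (localState L H v η γ i h).x fun j =>
      (localState L H v η γ i h).acc j + localEstimate L H v η γ i h r j, fun _ => 0⟩ := by
  simp only [localState, if_pos hr]
  rfl

theorem localState_cons_of_ne {i : Fin N} {r : Round N M} (h : History N M) (hr : r.k ≠ i) :
    localState L H v η γ i (r :: h) = ⟨(localState L H v η γ i h).x, fun j =>
      (localState L H v η γ i h).acc j + localEstimate L H v η γ i h r j⟩ := by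
  simp only [localState, if_neg hr]
  rfl

theorem localState_x_valid (i : Fin N) (h : History N M) :
    (∀ j ∈ nbrs L i, 0 < (localState L H v η γ i h).x j) ∧
      (∀ j ∉ nbrs L i, (localState L H v η γ i h).x j = 0) ∧
        ∑ j, (localState L H v η γ i h).x j = 1 := by
  induction h with
  | nil =>
    refine ⟨fun j hj => ?_, fun j hj => unif_eq_zero hj, sum_unif i⟩
    change 0 < unif L i j
    rw [unif_of_mem hj]
    exact one_div_pos.2 (card_nbrs_pos i)
  | cons r h ih =>
    obtain ⟨h1, h2, h3⟩ := ih
    have h0 : ∀ j, 0 ≤ (localState L H v η γ i h).x j := fun j => by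
      by_cases hj : j ∈ nbrs L i
      · exact (h1 j hj).le
      · exact (h2 j hj).ge
    by_cases hr : r.k = i
    · rw [localState_cons_of_eq h hr]
      refine ⟨fun j hj => ?_, fun j hj => ?_, sum_expWeights h0 h3 η⟩
      · dsimp only
        exact expWeights_pos h0 h3 η (h1 j hj)
      · simp [expWeights, h2 j hj]
    · rw [localState_cons_of_ne h hr]
      exact ⟨h1, h2, h3⟩

theorem localState_x_pos (h : History N M) {i j : Fin N} (hj : j ∈ nbrs L i) :
    0 < (localState L H v η γ i h).x j :=
  (localState_x_valid i h).1 j hj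

theorem localState_x_eq_zero (h : History N M) {i j : Fin N} (hj : j ∉ nbrs L i) :
    (localState L H v η γ i h).x j = 0 :=
  (localState_x_valid i h).2.1 j hj

theorem localState_x_nonneg (h : History N M) (i j : Fin N) :
    0 ≤ (localState L H v η γ i h).x j := by
  by_cases hj : j ∈ nbrs L i
  · exact (localState_x_pos h hj).le
  · exact (localState_x_eq_zero h hj).ge

theorem sum_localState_x (h : History N M) (i : Fin N) :
    ∑ j, (localState L H v η γ i h).x j = 1 :=
  (localState_x_valid i h).2.2

theorem localDist_eq (h : History N M) (i j : Fin N) :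
    localDist L H v η γ h i j = (1 - γ) * (localState L H v η γ i h).x j + γ * unif L i j := rfl

theorem localDist_nonneg (hγ0 : 0 ≤ γ) (hγ1 : γ ≤ 1) (h : History N M) (i j : Fin N) :
    0 ≤ localDist L H v η γ h i j :=
  add_nonneg (mul_nonneg (by linarith) (localState_x_nonneg h i j))
    (mul_nonneg hγ0 (unif_nonneg i j))

theorem localDist_pos (hγ0 : 0 ≤ γ) (hγ1 : γ < 1) (h : History N M) {i j : Fin N}
    (hj : j ∈ nbrs L i) : 0 < localDist L H v η γ h i j :=
  add_pos_of_pos_of_nonneg (mul_pos (by linarith) (localState_x_pos h hj))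
    (mul_nonneg hγ0 (unif_nonneg i j))

theorem sum_localDist (h : History N M) (i : Fin N) : ∑ j, localDist L H v η γ h i j = 1 := by
  simp only [localDist_eq, Finset.sum_add_distrib, ← Finset.mul_sum, sum_localState_x, sum_unif]
  ring

theorem localEstimate_of_mem (h : History N M) (r : Round N M) {i j : Fin N} (hj : j ∈ nbrs L i) :
    localEstimate L H v η γ i h r j = (if r.I = i then ownWeight v i j r.col else 0)
      + if r.k = i ∧ r.I = j then otherWeight v i j r.col / localDist L H v η γ h i j else 0 := by
  rw [localEstimate, if_pos hj, estimate_eq]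

/-- The number of rounds since the last update of the local algorithm `k` in which action `k` was
played. -/
def playCount (k : Fin N) : History N M → ℕ
  | [] => 0
  | r :: h => if r.k = k then 0 else playCount k h + if r.I = k then 1 else 0

/-- In a round that does not draw `i`, only the first block of the estimate can be nonzero. It
carries no importance weight and appears only when `i` is played. -/
theorem abs_localState_acc_le (hb : IsMaxNorm L H v vbar) {i j : Fin N} (hj : j ∈ nbrs L i)
    (h : History N M) : |(localState L H v η γ i h).acc j| ≤ vbar * playCount i h := by
  induction h with
  | nil => simp [localState, playCount]
  | cons r h ih =>
    by_cases hr : r.k = i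
    · simp [localState_cons_of_eq h hr, playCount, hr]
    · rw [localState_cons_of_ne h hr, playCount, if_neg hr]
      refine (abs_add_le _ _).trans ?_
      rw [localEstimate_of_mem h r hj]
      simp only [hr, false_and, if_false, add_zero]
      have := abs_ownWeight_le hb (mem_nbrs.1 hj) r.col
      split_ifs <;> push_cast
      · linarith
      · simpa using ih

end State

/-! ### The potential of a local algorithm -/

section Potential

variable {N M : ℕ} {A : Type*} [DecidableEq A] {L : Matrix (Fin N) (Fin M) ℝ}
  {H : Matrix (Fin N) (Fin M) A} {v : ObsVectors H} {η γ vbar : ℝ}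

/-- The potential of the local algorithm `k` relative to the comparator `j`. The last summand pays
in advance for the second-order cost of the estimates that wait for the next update. -/
noncomputable def localPotential (L : Matrix (Fin N) (Fin M) ℝ) (H : Matrix (Fin N) (Fin M) A)
    (v : ObsVectors H) (η γ C : ℝ) (k j : Fin N) (h : History N M) : ℝ :=
  -Real.log ((localState L H v η γ k h).x j)
    + η * ((localState L H v η γ k h).acc j
      - ∑ l, (localState L H v η γ k h).x l * (localState L H v η γ k h).acc l)
    + C * ((3 / 2) ^ playCount k h - 1)

theorem localPotential_nil (C : ℝ) {k j : Fin N} (hj : j ∈ nbrs L k) :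
    localPotential L H v η γ C k j [] = Real.log (nbrs L k).card := by
  simp [localPotential, localState, playCount, unif_of_mem hj]

/-- A fictitious update with the waiting estimates alone bounds the first two summands from below by
minus its second-order cost, and the geometric reserve covers this cost. -/
theorem localPotential_nonneg (hb : IsMaxNorm L H v vbar) (hη : 0 ≤ η) {C : ℝ}
    (hε : η * vbar ≤ 1 / 48) (hC : 6 * (η * vbar) ^ 2 ≤ C) {k j : Fin N}
    (hj : j ∈ nbrs L k) (h : History N M) : 0 ≤ localPotential L H v η γ C k j h := by
  have h1 := neg_log_add_nonneg (x := (localState L H v η γ k h).x)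
    (f := (localState L H v η γ k h).acc)
    (localState_x_nonneg h k) (sum_localState_x h k) η (localState_x_pos h hj)
  refine h1.trans (add_le_add_right ?_ _)
  set n := playCount k h
  have h2 : ∀ l, (localState L H v η γ k h).x l *
      (Real.exp (-(η * (localState L H v η γ k h).acc l)) - 1
        + η * (localState L H v η γ k h).acc l)
      ≤ (localState L H v η γ k h).x l
        * ((η * vbar * n) ^ 2 / 2 * Real.exp (η * vbar * n)) := by
    intro l
    by_cases hl : l ∈ nbrs L k
    · refine mul_le_mul_of_nonneg_left (exp_neg_sub_one_add_le ?_) (localState_x_nonneg h k l)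
      rw [abs_mul, abs_of_nonneg hη, mul_assoc]
      exact mul_le_mul_of_nonneg_left (abs_localState_acc_le hb hl h) hη
    · simp [localState_x_eq_zero h hl]
  refine (Finset.sum_le_sum fun l _ => h2 l).trans ?_
  rw [← Finset.sum_mul, sum_localState_x, one_mul]
  have h3 := sq_mul_exp_le_sub_one hε n
  have h4 : (0 : ℝ) ≤ (3 / 2) ^ n - 1 := by
    have : (1 : ℝ) ≤ (3 / 2) ^ n := one_le_pow₀ (by norm_num)
    linarith
  calc (η * vbar * n) ^ 2 / 2 * Real.exp (η * vbar * n)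
      = (η * vbar) ^ 2 / 2 * ((n : ℝ) ^ 2 * Real.exp (η * vbar * n)) := by ring
    _ ≤ (η * vbar) ^ 2 / 2 * (12 * ((3 / 2) ^ n - 1)) := by gcongr
    _ = 6 * (η * vbar) ^ 2 * ((3 / 2) ^ n - 1) := by ring
    _ ≤ _ := by gcongr

/-- The second-order cost of an update of the local algorithm `k` after the round `r`. -/
noncomputable def updateCost (L : Matrix (Fin N) (Fin M) ℝ) (H : Matrix (Fin N) (Fin M) A)
    (v : ObsVectors H) (η γ : ℝ) (k : Fin N) (h : History N M) (r : Round N M) : ℝ :=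
  ∑ l, (localState L H v η γ k h).x l *
    (Real.exp (-(η * ((localState L H v η γ k h).acc l + localEstimate L H v η γ k h r l))) - 1
      + η * ((localState L H v η γ k h).acc l + localEstimate L H v η γ k h r l))

theorem localPotential_cons_le (C : ℝ) {k j : Fin N} (hj : j ∈ nbrs L k) (h : History N M)
    (r : Round N M) :
    localPotential L H v η γ C k j (r :: h) ≤ localPotential L H v η γ C k j h
      + η * (localEstimate L H v η γ k h r j
        - ∑ l, (localState L H v η γ k h).x l * localEstimate L H v η γ k h r l)
      + if r.k = k then updateCost L H v η γ k h r - C * ((3 / 2) ^ playCount k h - 1)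
        else if r.I = k then C / 2 * (3 / 2) ^ playCount k h else 0 := by
  by_cases hr : r.k = k
  · have h1 := neg_log_expWeights_le (x := (localState L H v η γ k h).x)
      (f := fun l => (localState L H v η γ k h).acc l
      + localEstimate L H v η γ k h r l)
      (localState_x_nonneg h k) (sum_localState_x h k) η (localState_x_pos h hj)
    -- The update resets the accumulator and the count, so their contributions to the potential
    -- vanish.
    simp only [mul_add, Finset.sum_add_distrib] at h1
    simp only [localPotential, localState_cons_of_eq h hr, playCount, if_pos hr, updateCost,
      mul_add, Finset.sum_add_distrib, mul_zero, Finset.sum_const_zero, sub_self, pow_zero,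
      add_zero]
    linarith
  · simp only [localPotential, localState_cons_of_ne h hr, playCount, if_neg hr]
    simp only [mul_add, Finset.sum_add_distrib]
    split_ifs
    · rw [pow_succ]
      linarith
    · rw [add_zero]
      linarith

-- The cost vector has `playCount` waiting terms, one new unweighted term and one
-- importance-weighted term; exploration with `γ = 2 * N * ε` keeps `q l ≥ 2 * ε` on the neighbor
-- set.
theorem sum_mul_updateCost_le (hb : IsMaxNorm L H v vbar) (hvbar : 0 ≤ vbar) (hη : 0 ≤ η)
    (hε : η * vbar ≤ 1 / 48) (hN : 2 ≤ N) (hγ : γ = 2 * N * (η * vbar)) (hγ1 : γ ≤ 1 / 12)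
    (k : Fin N) (h : History N M) (c : Fin M) :
    ∑ I, localDist L H v η γ h k I * updateCost L H v η γ k h ⟨k, I, c⟩
      ≤ 8 * N * (η * vbar) ^ 2 * (3 / 2) ^ playCount k h := by
  have hε0 : 0 ≤ η * vbar := mul_nonneg hη hvbar
  have hγ0 : 0 ≤ γ := by rw [hγ]; positivity
  have key := sum_second_order_le (x := (localState L H v η γ k h).x)
    (q := localDist L H v η γ h k) (ε := η * vbar) (playCount k h)
    (y := fun I l => η * ((localState L H v η γ k h).acc l
      + localEstimate L H v η γ k h ⟨k, I, c⟩ l))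
    (localState_x_nonneg h k) (sum_localState_x h k)
    (localDist_nonneg hγ0 (by linarith) h k) (sum_localDist h k) ?_ hε0 hε ?_ ?_ (by simpa)
  · rw [Fintype.card_fin] at key
    exact key
  · intro l
    rw [localDist_eq]
    have h1 := mul_nonneg hγ0 (unif_nonneg (L := L) k l)
    have h2 := mul_nonneg (sub_nonneg.2 hγ1) (localState_x_nonneg (L := L) (H := H) (v := v)
      (η := η) (γ := γ) h k l)
    linarith
  · intro l hl
    have hl' : l ∈ nbrs L k := by
      by_contra hl'
      exact hl (localState_x_eq_zero h hl')
    have h1 : 1 / (N : ℝ) ≤ unif L k l := by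
      rw [unif_of_mem hl']
      exact one_div_le_one_div_of_le (card_nbrs_pos k) (card_nbrs_le k)
    have hN0 : (0 : ℝ) < N := by exact_mod_cast (by omega : 0 < N)
    have h2 := mul_le_mul_of_nonneg_left h1 hγ0
    have h3 : γ * (1 / N) = 2 * (η * vbar) := by
      rw [hγ]; field_simp
    have h4 : 0 ≤ (1 - γ) * (localState L H v η γ k h).x l :=
      mul_nonneg (by linarith) (localState_x_nonneg h k l)
    rw [localDist_eq]
    linarith
  · intro I l hl
    have hl' : l ∈ nbrs L k := by
      by_contra hl'
      exact hl (localState_x_eq_zero h hl')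
    have hq := localDist_pos (H := H) (v := v) (η := η) hγ0 (by linarith) h hl'
    have h1 := abs_localState_acc_le (η := η) (γ := γ) hb hl' h
    have h2 : |localEstimate L H v η γ k h ⟨k, I, c⟩ l|
        ≤ vbar + if I = l then vbar / localDist L H v η γ h k l else 0 := by
      rw [localEstimate_of_mem h _ hl']
      refine (abs_add_le _ _).trans (add_le_add ?_ ?_)
      · split_ifs
        · exact abs_ownWeight_le hb (mem_nbrs.1 hl') c
        · simpa using hvbar
      · simp only [true_and]
        split_ifs
        · rw [abs_div, abs_of_pos hq]
          exact div_le_div_of_nonneg_right (abs_otherWeight_le hb (mem_nbrs.1 hl') c) hq.le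
        · simp
    rw [abs_mul, abs_of_nonneg hη]
    have h3 := mul_le_mul_of_nonneg_left ((abs_add_le _ _).trans (add_le_add h1 h2)) hη
    refine h3.trans (le_of_eq ?_)
    split_ifs <;> ring

end Potential

/-! ### One round -/

section Round

variable {N : ℕ} {p : Fin N → ℝ} {q : Fin N → Fin N → ℝ}

theorem sum_flow_mul (hflow : ∀ a, ∑ k, p k * q k a = p a) (f : Fin N → ℝ) :
    ∑ k, ∑ I, p k * q k I * f I = ∑ I, p I * f I := by
  rw [Finset.sum_comm]
  simp only [← Finset.sum_mul, hflow]

theorem sum_flow_played (hflow : ∀ a, ∑ k, p k * q k a = p a) (i : Fin N) (a : ℝ) :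
    ∑ k, ∑ I, p k * q k I * (if I = i then a else 0) = p i * a := by
  rw [sum_flow_mul hflow]
  simp

theorem sum_flow_drawn (i j : Fin N) (a : ℝ) :
    ∑ k, ∑ I, p k * q k I * (if k = i ∧ I = j then a else 0) = p i * q i j * a := by
  simp only [ite_and, mul_ite, mul_zero]
  rw [Finset.sum_eq_single i (by intro k _ hk; simp [hk]) (by simp)]
  simp

/-- The event `I = i` has probability `p i` by the flow condition; dropping the requirement `k ≠ i`
only loses a nonnegative term. -/
theorem sum_flow_update_le (hp : ∀ k, 0 ≤ p k) (hq : ∀ k I, 0 ≤ q k I)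
    (hflow : ∀ a, ∑ k, p k * q k a = p a) (i : Fin N) (f : Fin N → ℝ) {g : ℝ} (hg : 0 ≤ g) :
    ∑ k, ∑ I, p k * q k I * (if k = i then f I else if I = i then g else 0)
      ≤ p i * (∑ I, q i I * f I + g) := by
  calc _ ≤ ∑ k, ∑ I, (p k * q k I * (if k = i then f I else 0)
        + p k * q k I * (if I = i then g else 0)) := by
        refine Finset.sum_le_sum fun k _ => Finset.sum_le_sum fun I _ => ?_
        have hw := mul_nonneg (hp k) (hq k I)
        have := mul_nonneg hw hg
        rw [← mul_add]
        refine mul_le_mul_of_nonneg_left ?_ hw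
        split_ifs <;> linarith
    _ = _ := by
        simp only [Finset.sum_add_distrib, sum_flow_played hflow]
        rw [Finset.sum_eq_single i (by intro k _ hk; simp [hk]) (by simp)]
        simp only [if_true, mul_add, Finset.mul_sum, mul_assoc]

end Round

/-! ### Conditional drift of the potentials and of the regret -/

section Drift

variable {N M : ℕ} {A : Type*} [DecidableEq A] {L : Matrix (Fin N) (Fin M) ℝ}
  {H : Matrix (Fin N) (Fin M) A} {v : ObsVectors H} {η γ vbar : ℝ}
  {p : History N M → Fin N → ℝ}

theorem IsStationaryChoice.flow (hp : IsStationaryChoice L H v η γ p) (h : History N M)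
    (a : Fin N) : ∑ k, p h k * localDist L H v η γ h k a = p h a := by
  conv_rhs => rw [(hp h).2]
  simp only [Matrix.mulVec, dotProduct, flowMatrix, Matrix.of_apply]
  exact Finset.sum_congr rfl fun _ _ => mul_comm _ _

theorem IsStationaryChoice.sum_weights (hp : IsStationaryChoice L H v η γ p) (h : History N M) :
    ∑ k, ∑ I, p h k * localDist L H v η γ h k I = 1 := by
  simp only [← Finset.mul_sum, sum_localDist, mul_one, (hp h).1.2]

theorem IsStationaryChoice.weight_nonneg (hp : IsStationaryChoice L H v η γ p) (hγ0 : 0 ≤ γ)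
    (hγ1 : γ ≤ 1) (h : History N M) (k I : Fin N) :
    0 ≤ p h k * localDist L H v η γ h k I :=
  mul_nonneg ((hp h).1.1 k) (localDist_nonneg hγ0 hγ1 h k I)

/-- The estimates are unbiased. -/
theorem sum_mul_localEstimate (hv : IsObsVectors L H v) (hp : IsStationaryChoice L H v η γ p)
    (hγ0 : 0 ≤ γ) (hγ1 : γ < 1) (h : History N M) (c : Fin M) {i j : Fin N}
    (hj : j ∈ nbrs L i) :
    ∑ k, ∑ I, p h k * localDist L H v η γ h k I * localEstimate L H v η γ i h ⟨k, I, c⟩ j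
      = p h i * (L j c - L i c) := by
  simp only [localEstimate_of_mem h _ hj, mul_add, Finset.sum_add_distrib]
  -- The own-signal half appears with probability `p i` by the flow condition; in the other half the
  -- probability `p i * q i j` cancels the weight `1 / q i j`.
  rw [sum_flow_played (hp.flow h), sum_flow_drawn, ← ownWeight_add_otherWeight hv (mem_nbrs.1 hj)]
  have := (localDist_pos (H := H) (v := v) (η := η) hγ0 hγ1 h hj).ne'
  field_simp

theorem sum_mul_localPotential_le (hv : IsObsVectors L H v) (hb : IsMaxNorm L H v vbar)
    (hp : IsStationaryChoice L H v η γ p) (hvbar : 0 ≤ vbar) (hη : 0 ≤ η)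
    (hε : η * vbar ≤ 1 / 48) (hN : 2 ≤ N) (hγ : γ = 2 * N * (η * vbar)) (hγ1 : γ ≤ 1 / 12)
    (h : History N M) (c : Fin M) {i j : Fin N} (hj : j ∈ nbrs L i) :
    ∑ k, ∑ I, p h k * localDist L H v η γ h k I
        * localPotential L H v η γ (16 * N * (η * vbar) ^ 2) i j (⟨k, I, c⟩ :: h)
      ≤ localPotential L H v η γ (16 * N * (η * vbar) ^ 2) i j h
        + p h i * (η * (L j c - ∑ l, (localState L H v η γ i h).x l * L l c)
          + 16 * N * (η * vbar) ^ 2) := by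
  have hε0 : 0 ≤ η * vbar := mul_nonneg hη hvbar
  have hγ0 : 0 ≤ γ := by rw [hγ]; positivity
  set C : ℝ := 16 * N * (η * vbar) ^ 2 with hC
  set n := playCount i h with hn
  set x := (localState L H v η γ i h).x with hx
  have hx1 : ∑ l, x l = 1 := sum_localState_x h i
  have hw := hp.weight_nonneg hγ0 (by linarith) h
  have hest := fun l (hl : l ∈ nbrs L i) => sum_mul_localEstimate hv hp hγ0 (by linarith) h c hl
  refine (Finset.sum_le_sum fun k _ => Finset.sum_le_sum fun I _ =>
    mul_le_mul_of_nonneg_left (localPotential_cons_le C hj h ⟨k, I, c⟩) (hw k I)).trans ?_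
  simp only [mul_add, Finset.sum_add_distrib]
  have e1 : ∑ k, ∑ I, p h k * localDist L H v η γ h k I * localPotential L H v η γ C i j h
      = localPotential L H v η γ C i j h := by
    simp only [← Finset.sum_mul, hp.sum_weights h, one_mul]
  have e2 : ∑ k, ∑ I, p h k * localDist L H v η γ h k I
      * (η * (localEstimate L H v η γ i h ⟨k, I, c⟩ j
        - ∑ l, x l * localEstimate L H v η γ i h ⟨k, I, c⟩ l))
      = p h i * (η * (L j c - ∑ l, x l * L l c)) := by
    have e3 : ∑ k, ∑ I, p h k * localDist L H v η γ h k I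
        * ∑ l, x l * localEstimate L H v η γ i h ⟨k, I, c⟩ l
        = ∑ l, x l * (p h i * (L l c - L i c)) := by
      simp only [Finset.mul_sum]
      rw [Finset.sum_comm_cycle]
      refine Finset.sum_congr rfl fun l _ => ?_
      by_cases hl : l ∈ nbrs L i
      · rw [← hest l hl]
        simp only [Finset.mul_sum]
        exact Finset.sum_congr rfl fun _ _ => Finset.sum_congr rfl fun _ _ => by ring
      · simp [hx, localState_x_eq_zero h hl]
    have e4 : ∑ l, x l * (p h i * (L l c - L i c))
        = p h i * (∑ l, x l * L l c - L i c) := by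
      simp only [mul_sub, Finset.sum_sub_distrib, ← Finset.sum_mul, hx1, Finset.mul_sum]
      rw [one_mul]
      congr 1
      exact Finset.sum_congr rfl fun _ _ => by ring
    have e5 : ∀ k I, p h k * localDist L H v η γ h k I
        * (η * (localEstimate L H v η γ i h ⟨k, I, c⟩ j
          - ∑ l, x l * localEstimate L H v η γ i h ⟨k, I, c⟩ l))
        = η * (p h k * localDist L H v η γ h k I * localEstimate L H v η γ i h ⟨k, I, c⟩ j)
          - η * (p h k * localDist L H v η γ h k I
            * ∑ l, x l * localEstimate L H v η γ i h ⟨k, I, c⟩ l) := fun k I => by ring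
    simp only [e5, Finset.sum_sub_distrib, ← Finset.mul_sum]
    rw [e3, e4, hest j hj]
    ring
  have e6 := sum_flow_update_le (q := localDist L H v η γ h) (hp h).1.1
    (localDist_nonneg hγ0 (by linarith) h) (hp.flow h) i
    (fun I => updateCost L H v η γ i h ⟨i, I, c⟩ - C * ((3 / 2) ^ n - 1))
    (by positivity : 0 ≤ C / 2 * (3 / 2) ^ n)
  -- With `g = (3/2)^n` the balance is `C/2 * g - C * (g - 1) + C/2 * g = C`: update cost, released
  -- reserve, increment for a play.
  have e7 : ∑ I, localDist L H v η γ h i I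
      * (updateCost L H v η γ i h ⟨i, I, c⟩ - C * ((3 / 2) ^ n - 1)) + C / 2 * (3 / 2) ^ n
      ≤ C := by
    have := sum_mul_updateCost_le hb hvbar hη hε hN hγ hγ1 i h c
    simp only [mul_sub (localDist L H v η γ h i _), Finset.sum_sub_distrib, ← Finset.sum_mul,
      sum_localDist]
    rw [hC]
    linarith
  have e8 := e6.trans (mul_le_mul_of_nonneg_left e7 ((hp h).1.1 i))
  have e9 : ∑ k, ∑ I, p h k * localDist L H v η γ h k I *
      (if k = i then updateCost L H v η γ i h ⟨k, I, c⟩ - C * ((3 / 2) ^ n - 1)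
        else if I = i then C / 2 * (3 / 2) ^ n else 0)
      = ∑ k, ∑ I, p h k * localDist L H v η γ h k I *
      (if k = i then updateCost L H v η γ i h ⟨i, I, c⟩ - C * ((3 / 2) ^ n - 1)
        else if I = i then C / 2 * (3 / 2) ^ n else 0) := by
    refine Finset.sum_congr rfl fun k _ => Finset.sum_congr rfl fun I _ => ?_
    by_cases hk : k = i
    · rw [hk]
    · simp [hk]
  rw [e1, e2, e9]
  linarith

/-- The price of exploration. -/
theorem sum_localDist_mul_loss_le (hv : IsObsVectors L H v) (hb : IsMaxNorm L H v vbar)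
    (hγ0 : 0 ≤ γ) (h : History N M) (c : Fin M) (i : Fin N) :
    ∑ l, localDist L H v η γ h i l * L l c
      ≤ ∑ l, (localState L H v η γ i h).x l * L l c + 4 * γ * vbar := by
  set x := (localState L H v η γ i h).x with hx
  have hx1 : ∑ l, x l = 1 := sum_localState_x h i
  -- Both distributions have mass one, so subtracting `L i c` changes nothing and leaves only loss
  -- differences between neighbors, each at most `2 * vbar`.
  have h1 : ∑ l, localDist L H v η γ h i l * L l c - ∑ l, x l * L l c
      = γ * ∑ l, (unif L i l - x l) * (L l c - L i c) := by
    have e : ∑ l, (unif L i l - x l) * L i c = 0 := by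
      rw [← Finset.sum_mul, Finset.sum_sub_distrib, sum_unif, hx1]; simp
    simp only [mul_sub (_ - _), Finset.sum_sub_distrib]
    rw [e, sub_zero, Finset.mul_sum, ← Finset.sum_sub_distrib]
    refine Finset.sum_congr rfl fun l _ => ?_
    rw [localDist_eq]
    ring
  have h2 : ∑ l, (unif L i l - x l) * (L l c - L i c) ≤ ∑ l, (unif L i l + x l) * (2 * vbar) := by
    refine Finset.sum_le_sum fun l _ => ?_
    by_cases hl : l ∈ nbrs L i
    · have h3 := abs_le.1 (abs_loss_sub_le hv hb (mem_nbrs.1 hl) c)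
      have h4 := mul_nonneg (unif_nonneg (L := L) i l) (sub_nonneg.2 h3.2)
      have h5 := mul_nonneg (localState_x_nonneg (L := L) (H := H) (v := v) (η := η) (γ := γ)
        h i l) (sub_nonneg.2 h3.1)
      rw [← hx] at h5
      linarith
    · simp [hx, localState_x_eq_zero h hl, unif_eq_zero hl]
  rw [← Finset.sum_mul, Finset.sum_add_distrib, sum_unif, hx1] at h2
  have h6 := mul_le_mul_of_nonneg_left h2 hγ0
  linarith

theorem regret_cons (φ : Fin N → Fin N) (r : Round N M) (h : History N M) :
    regret L φ (r :: h) = (L r.I r.col - L (φ r.I) r.col) + regret L φ h := by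
  simp [regret]

theorem sum_mul_regret (hp : IsStationaryChoice L H v η γ p) (φ : Fin N → Fin N)
    (h : History N M) (c : Fin M) :
    ∑ k, ∑ I, p h k * localDist L H v η γ h k I * regret L φ (⟨k, I, c⟩ :: h)
      = regret L φ h + ∑ i, p h i * (L i c - L (φ i) c) := by
  simp only [regret_cons, mul_add, Finset.sum_add_distrib]
  rw [sum_flow_mul (hp.flow h) fun I => L I c - L (φ I) c]
  simp only [← Finset.sum_mul, hp.sum_weights h]
  ring

/-- The drift of the total potential. -/
theorem sum_mul_potential_le (hv : IsObsVectors L H v) (hb : IsMaxNorm L H v vbar)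
    (hp : IsStationaryChoice L H v η γ p) (hvbar : 0 ≤ vbar) (hη : 0 ≤ η)
    (hε : η * vbar ≤ 1 / 48) (hN : 2 ≤ N) (hγ : γ = 2 * N * (η * vbar)) (hγ1 : γ ≤ 1 / 12)
    {φ : Fin N → Fin N} (hφ : ∀ i, φ i ∈ nbrs L i) (h : History N M) (c : Fin M) :
    ∑ k, ∑ I, p h k * localDist L H v η γ h k I * (η * regret L φ (⟨k, I, c⟩ :: h)
        + ∑ i, localPotential L H v η γ (16 * N * (η * vbar) ^ 2) i (φ i) (⟨k, I, c⟩ :: h))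
      ≤ (η * regret L φ h
        + ∑ i, localPotential L H v η γ (16 * N * (η * vbar) ^ 2) i (φ i) h)
        + 24 * N * (η * vbar) ^ 2 := by
  have hε0 : 0 ≤ η * vbar := mul_nonneg hη hvbar
  have hγ0 : 0 ≤ γ := by rw [hγ]; positivity
  have h1 : ∑ k, ∑ I, p h k * localDist L H v η γ h k I * ∑ i,
        localPotential L H v η γ (16 * N * (η * vbar) ^ 2) i (φ i) (⟨k, I, c⟩ :: h)
      = ∑ i, ∑ k, ∑ I, p h k * localDist L H v η γ h k I *
        localPotential L H v η γ (16 * N * (η * vbar) ^ 2) i (φ i) (⟨k, I, c⟩ :: h) := by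
    simp only [Finset.mul_sum]
    rw [Finset.sum_comm_cycle]
  have h2 : ∑ k, ∑ I, p h k * localDist L H v η γ h k I * (η * regret L φ (⟨k, I, c⟩ :: h))
      = η * (regret L φ h + ∑ i, p h i * (L i c - L (φ i) c)) := by
    rw [← sum_mul_regret hp φ h c]
    simp only [Finset.mul_sum]
    exact Finset.sum_congr rfl fun _ _ => Finset.sum_congr rfl fun _ _ => by ring
  have h3 := Finset.sum_le_sum fun i (_ : i ∈ Finset.univ) =>
    sum_mul_localPotential_le hv hb hp hvbar hη hε hN hγ hγ1 h c (hφ i)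
  rw [Finset.sum_add_distrib] at h3
  simp only [mul_add, Finset.sum_add_distrib]
  rw [h1, h2]
  -- Here the flow condition replaces the loss of the played action by the losses of the local
  -- algorithms.
  have h4 : ∑ i, p h i * L i c = ∑ i, p h i * ∑ l, localDist L H v η γ h i l * L l c := by
    rw [← sum_flow_mul (hp.flow h) fun I => L I c]
    simp only [Finset.mul_sum, mul_assoc]
  -- The comparator terms cancel; what remains is exploration, `η * 4 * γ * vbar = 8 * N * ε^2`, and
  -- the second-order term `16 * N * ε^2`.
  have h5 : η * ∑ i, p h i * (L i c - L (φ i) c)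
      + ∑ i, p h i * (η * (L (φ i) c - ∑ l, (localState L H v η γ i h).x l * L l c)
          + 16 * N * (η * vbar) ^ 2) ≤ 24 * N * (η * vbar) ^ 2 := by
    calc _ = ∑ i, p h i * (η * (∑ l, localDist L H v η γ h i l * L l c
          - ∑ l, (localState L H v η γ i h).x l * L l c) + 16 * N * (η * vbar) ^ 2) := by
          have e : ∑ i, p h i * (L i c - L (φ i) c) = ∑ i, p h i *
              (∑ l, localDist L H v η γ h i l * L l c - L (φ i) c) := by
            simp only [mul_sub, Finset.sum_sub_distrib, h4]
          rw [e, Finset.mul_sum, ← Finset.sum_add_distrib]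
          exact Finset.sum_congr rfl fun _ _ => by ring
      _ ≤ ∑ i, p h i * (24 * N * (η * vbar) ^ 2) := by
          refine Finset.sum_le_sum fun i _ => mul_le_mul_of_nonneg_left ?_ ((hp h).1.1 i)
          have e := sub_le_iff_le_add'.2 (sum_localDist_mul_loss_le (η := η) hv hb hγ0 h c i)
          have e' := mul_le_mul_of_nonneg_left e hη
          have e2 : η * (4 * γ * vbar) = 8 * N * (η * vbar) ^ 2 := by rw [hγ]; ring
          linarith
      _ = _ := by rw [← Finset.sum_mul, (hp h).1.2, one_mul]
  linarith

end Drift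

/-! ### Regret bounds for general parameters -/

section Bounds

variable {N M : ℕ} {A : Type*} [DecidableEq A] {L : Matrix (Fin N) (Fin M) ℝ}
  {H : Matrix (Fin N) (Fin M) A} {v : ObsVectors H} {η γ vbar : ℝ}
  {p : History N M → Fin N → ℝ} {adv : History N M → Fin M → ℝ}

theorem expect_regret_le_linear (hv : IsObsVectors L H v) (hb : IsMaxNorm L H v vbar)
    (hp : IsStationaryChoice L H v η γ p) (hadv : IsAdversary adv) (hγ0 : 0 ≤ γ) (hγ1 : γ ≤ 1)
    {φ : Fin N → Fin N} (hφ : ∀ i, φ i ∈ nbrs L i) (T : ℕ) :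
    expect L H v η γ p adv T (regret L φ) ≤ 2 * vbar * T := by
  have h := expect_le_of_drift (F := regret L φ) (C := 2 * vbar) hadv
    (hp.weight_nonneg hγ0 hγ1) hp.sum_weights ?_ T
  · simp only [regret, List.map_nil, List.sum_nil, zero_add] at h
    rw [mul_comm]
    exact h
  · intro h c
    rw [sum_mul_regret hp]
    refine add_le_add_right ?_ _
    calc _ ≤ ∑ i, p h i * (2 * vbar) := by
          refine Finset.sum_le_sum fun i _ => mul_le_mul_of_nonneg_left ?_ ((hp h).1.1 i)
          have := (abs_le.1 (abs_loss_sub_le hv hb (mem_nbrs.1 (hφ i)) c)).1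
          linarith
      _ = _ := by rw [← Finset.sum_mul, (hp h).1.2, one_mul]

theorem mul_expect_regret_le (hv : IsObsVectors L H v) (hb : IsMaxNorm L H v vbar)
    (hp : IsStationaryChoice L H v η γ p) (hadv : IsAdversary adv) (hvbar : 0 ≤ vbar) (hη : 0 ≤ η)
    (hε : η * vbar ≤ 1 / 48) (hN : 2 ≤ N) (hγ : γ = 2 * N * (η * vbar)) (hγ1 : γ ≤ 1 / 12)
    {φ : Fin N → Fin N} (hφ : ∀ i, φ i ∈ nbrs L i) (T : ℕ) :
    η * expect L H v η γ p adv T (regret L φ)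
      ≤ N * Real.log N + T * (24 * N * (η * vbar) ^ 2) := by
  have hγ0 : 0 ≤ γ := by rw [hγ]; positivity
  have h1 := expect_le_of_drift (F := fun h => η * regret L φ h
      + ∑ i, localPotential L H v η γ (16 * N * (η * vbar) ^ 2) i (φ i) h) hadv (hp.weight_nonneg hγ0 (by linarith)) hp.sum_weights
    (sum_mul_potential_le hv hb hp hvbar hη hε hN hγ hγ1 hφ) T
  have hN' : (2 : ℝ) ≤ N := by exact_mod_cast hN
  have h2 := expect_mono (L := L) (H := H) (v := v) (η := η) (γ := γ) (p := p) (adv := adv)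
    (F := fun h => η * regret L φ h) (G := fun h => η * regret L φ h
      + ∑ i, localPotential L H v η γ (16 * N * (η * vbar) ^ 2) i (φ i) h)
    (fun h k I c => mul_nonneg (hp.weight_nonneg hγ0 (by linarith) h k I) ((hadv h).1 c)) T
    fun h => le_add_of_nonneg_right (Finset.sum_nonneg fun i _ =>
      localPotential_nonneg hb hη hε
        (mul_le_mul_of_nonneg_right (by linarith) (sq_nonneg _)) (hφ i) h)
  rw [expect_const_mul] at h2
  refine h2.trans (h1.trans (add_le_add_left ?_ _))
  simp only [localPotential_nil _ (hφ _), regret, List.map_nil, List.sum_nil, mul_zero, zero_add]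
  calc ∑ i, Real.log (nbrs L i).card ≤ ∑ _i : Fin N, Real.log N :=
        Finset.sum_le_sum fun i _ => Real.log_le_log (card_nbrs_pos i) (card_nbrs_le i)
    _ = _ := by simp

end Bounds

theorem IsLocalDeparture.mem_nbrs {N M : ℕ} {L : Matrix (Fin N) (Fin M) ℝ} {φ : Fin N → Fin N}
    (hφ : IsLocalDeparture L φ) (k : Fin N) : φ k ∈ nbrs L k := by
  obtain ⟨i, j, hij, rfl⟩ := hφ
  rcases eq_or_ne k i with rfl | hk
  · rw [Function.update_self]
    exact PartialMonitoring.mem_nbrs.2 hij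
  · rw [Function.update_of_ne hk]
    exact self_mem_nbrs k

theorem IsMaxNorm.nonneg {N M : ℕ} {A : Type*} [DecidableEq A] {L : Matrix (Fin N) (Fin M) ℝ}
    {H : Matrix (Fin N) (Fin M) A} {v : ObsVectors H} {vbar : ℝ} (hb : IsMaxNorm L H v vbar)
    (i : Fin N) : 0 ≤ vbar :=
  (norm_nonneg (v i i)).trans (norm_le_of_isMaxNorm hb (Or.inl rfl))

end PartialMonitoring

/-! ### Choice of the exploration rate and conclusion -/

theorem theorem1 (N T : ℕ) (vbar : ℝ) :
    ∃ γ : ℝ, 0 ≤ γ ∧ γ < 1 / 2 ∧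
      ∀ (M : ℕ) (A : Type*) [DecidableEq A]
        (L : Matrix (Fin N) (Fin M) ℝ) (H : Matrix (Fin N) (Fin M) A)
        (v : PartialMonitoring.ObsVectors H)
        (p : PartialMonitoring.History N M → Fin N → ℝ)
        (adv : PartialMonitoring.History N M → Fin M → ℝ),
        PartialMonitoring.Nondegenerate L →
        PartialMonitoring.LocallyObservable L H →
        PartialMonitoring.IsObsVectors L H v →
        PartialMonitoring.IsMaxNorm L H v vbar →
        PartialMonitoring.IsStationaryChoice L H v
          (PartialMonitoring.learningRate N T vbar) γ p →
        PartialMonitoring.IsAdversary adv →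
        ∀ φ : Fin N → Fin N, PartialMonitoring.IsLocalDeparture L φ →
          PartialMonitoring.expect L H v (PartialMonitoring.learningRate N T vbar) γ p adv T
              (PartialMonitoring.regret L φ)
            ≤ 4 * N * vbar * Real.sqrt (6 * Real.log N * T) := by
  set ε : ℝ := Real.sqrt (Real.log N / (24 * T)) with hεdef
  -- The threshold is where `N * ε` passes `1/24`. Below it the bound linear in `T` is strong
  -- enough, even without exploration.
  by_cases hT : (T : ℝ) ≤ 24 * N ^ 2 * Real.log N
  · refine ⟨0, le_rfl, by norm_num, ?_⟩
    intro M A _ L H v p adv _ _ hv hb hp hadv φ hφ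
    have hφ' := hφ.mem_nbrs
    -- The departure function supplies an action, which forces `0 ≤ vbar`.
    obtain ⟨i, _⟩ := hφ
    have hvbar := hb.nonneg i
    refine (PartialMonitoring.expect_regret_le_linear hv hb hp hadv le_rfl zero_le_one hφ'
      T).trans ?_
    have h1 : (T : ℝ) ≤ 2 * N * Real.sqrt (6 * Real.log N * T) := by
      have h0 : (0 : ℝ) ≤ 2 * N := by positivity
      rw [← Real.sqrt_sq h0, ← Real.sqrt_mul (sq_nonneg _)]
      refine Real.le_sqrt_of_sq_le ?_
      have := mul_le_mul_of_nonneg_right hT (Nat.cast_nonneg (α := ℝ) T)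
      linarith
    have := mul_le_mul_of_nonneg_left h1 (by positivity : 0 ≤ 2 * vbar)
    linarith
  · rw [not_le] at hT
    have hlog : 0 ≤ Real.log N := Real.log_natCast_nonneg N
    have hT0 : (0 : ℝ) < T := lt_of_le_of_lt (by positivity) hT
    have hε0 : 0 ≤ ε := Real.sqrt_nonneg _
    have hε2 : ε ^ 2 = Real.log N / (24 * T) := Real.sq_sqrt (by positivity)
    have hNε : N * ε ≤ 1 / 24 := by
      refine abs_le_of_sq_le_sq' ?_ (by norm_num) |>.2
      rw [mul_pow, hε2, ← mul_div_assoc, div_le_iff₀ (by positivity)]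
      linarith
    refine ⟨2 * N * ε, by positivity, by linarith, ?_⟩
    intro M A _ L H v p adv _ _ hv hb hp hadv φ hφ
    have hφ' := hφ.mem_nbrs
    obtain ⟨i, _⟩ := hφ
    have hvbar := hb.nonneg i
    have hrhs : 0 ≤ 4 * N * vbar * Real.sqrt (6 * Real.log N * T) := by positivity
    -- If `vbar = 0`, neighbors have equal losses and the linear bound is already zero.
    rcases hvbar.eq_or_lt with hv0 | hvpos
    · refine (PartialMonitoring.expect_regret_le_linear hv hb hp hadv (by positivity)
        (by linarith) hφ' T).trans ?_
      rw [← hv0]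
      simp
    rcases lt_or_ge N 2 with hN | hN
    · have hN1 : N = 1 := by have := i.2; omega
      subst hN1
      -- Writing the zero regret as a product lets `expect_const_mul` evaluate its expectation.
      have hreg : PartialMonitoring.regret L φ = fun _ => 0 * 0 := by
        funext h
        have : ∀ r : PartialMonitoring.Round 1 M, φ r.I = r.I := fun r => Subsingleton.elim _ _
        simp [PartialMonitoring.regret, this]
      rw [hreg, PartialMonitoring.expect_const_mul, zero_mul]
      exact hrhs
    · have hN' : (2 : ℝ) ≤ N := by exact_mod_cast hN
      have hlogpos : 0 < Real.log N := Real.log_pos (by linarith)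
      have hη0 : 0 < PartialMonitoring.learningRate N T vbar := Real.sqrt_pos.2 (by positivity)
      have hηε : PartialMonitoring.learningRate N T vbar * vbar = ε := by
        rw [PartialMonitoring.learningRate, hεdef]
        nth_rewrite 2 [← Real.sqrt_sq hvbar]
        rw [← Real.sqrt_mul (by positivity)]
        congr 1
        field_simp
      set η := PartialMonitoring.learningRate N T vbar
      -- `N ≥ 2` and `N * ε ≤ 1/24` give `ε ≤ 1/48`.
      have key := PartialMonitoring.mul_expect_regret_le hv hb hp hadv hvbar hη0.le
        (by rw [hηε]; nlinarith) hN (by rw [hηε]) (by linarith) hφ' T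
      refine le_of_mul_le_mul_left (key.trans (le_of_eq ?_)) hη0
      have hprod : ε * Real.sqrt (6 * Real.log N * T) = Real.log N / 2 := by
        rw [hεdef, ← Real.sqrt_mul (by positivity), ← Real.sqrt_sq (by positivity :
          0 ≤ Real.log N / 2)]
        congr 1
        field_simp
        norm_num
      rw [hηε, hε2]
      calc N * Real.log N + T * (24 * N * (Real.log N / (24 * T)))
          = 4 * N * (Real.log N / 2) := by field_simp; ring
        _ = 4 * N * (ε * Real.sqrt (6 * Real.log N * T)) := by rw [hprod]
        _ = _ := by rw [← hηε]; ring
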